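/- Let $U$ be a set of urelements with superstructure $V(U)=\bigcup_n V_n(U)$, where $V_0(U)=U$ and $V_{n+1}(U)=U\cup\mathcal P(V_n(U))$, and let ${}^*$ be the extension given by ultrapowers with respect to an ultrafilter $\mathcal U$: ${}^*X=X^I/\mathcal U$. Elements of ${}^*\mathcal P(X)$ are identified with subsets of ${}^*X$; these are the internal subsets. Assume that the ultrapower satisfies the concurrency principle for internal relations: whenever $X,Y$ are sets belonging to $V(U)$ and $r\subseteq{}^*X\times{}^*Y$ is internal and such that for every finite $C\subseteq X$ there is $b\in{}^*Y$ with ${}^*x\mathrel r b$ for all $x\in C$, there is a single $b\in{}^*Y$ with ${}^*x\mathrel r b$ for all $x\in X$. Let $\mathbb A=(A,\mathcal O)$ be an algebra with $A\subseteq U$ and with an arbitrary (possibly infinite) indexed family $\mathcal O$ of finitary operations, and let $G\subseteq A$ generate $\mathbb A$. Identify $a\in A$ with ${}^*a\in{}^*A$. A *subalgebra* of ${}^*\mathbb A$ is a subset of ${}^*A$ closed under all internal operations $o\in{}^*\mathcal O$ (of arity $\eta_o\in{}^*\mathbb N$), applied to internal $\eta_o$-tuples all of whose entries lie in the subset. The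 *extension monad* of $\mathbb A$ is $$\hat{\mathbb A}=\bigcap\{\mathbb B\le{}^*\mathbb A : \mathbb B\text{ internal},\ A\subseteq B\}.$$ For an internal $F\subseteq{}^*A$ let $(A_\nu(F))_{\nu\in{}^*\mathbb N}$ be the internal sequence given by internal recursion, $A_0(F)=F$ and $$A_{\nu+1}(F)=A_\nu(F)\cup\{o(x_1,\dots,x_{\eta_o}) : o\in{}^*\mathcal O,\ (x_1,\dots,x_{\eta_o})\text{ an internal tuple in }A_\nu(F)\},$$ and for an arbitrary, possibly external, $S\subseteq{}^*A$ put $$\check S=\bigcup\{A_\nu(F) : F\subseteq S\text{ internal},\ \nu\in{}^*\mathbb N\}$$ (so that $\check S=\bigcup_{\nu\in{}^*\mathbb N}A_\nu(S)$ when $S$ is internal). Then $$\hat{\mathbb A}=\check G .$$ -/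

import Mathlib

open Filter

universe u v w w'

namespace ExtMonad

/-! ### Ultrapowers of a superstructure -/

/-- The levels `V₀(U) = U`, `Vₙ₊₁(U) = U ∪ 𝒫(Vₙ(U))` of the superstructure `V(U)` over the set `U`
of urelements. Every set belonging to `V(U)` is a subset of some `Vₙ(U)`. -/
def Level (U : Type u) : ℕ → Type u
  | 0 => U
  | n + 1 => U ⊕ Set (Level U n)

section

variable {I : Type v} (𝒰 : Ultrafilter I)

/-- The `*`-transform `*X` of a set `X`: its ultrapower. -/
abbrev Star (X : Type*) := Germ (𝒰 : Filter I) X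

variable {𝒰}

/-- An element `s` of `*𝒫(X)`, seen as an actual subset of `*X`: `{x ∈ *X | x *∈ s}`. -/
def internalSet {X : Type*} (s : Star 𝒰 (Set X)) : Set (Star 𝒰 X) :=
  {x | Germ.LiftRel (fun a S => a ∈ S) x s}

/-- A subset of `*X` is internal if it is given by an element of `*𝒫(X)`. -/
def IsInternal {X : Type*} (S : Set (Star 𝒰 X)) : Prop :=
  ∃ s : Star 𝒰 (Set X), S = internalSet s

/-- An internal relation `r ⊆ *X × *Y` is concurrent on the standard set `X` if every finite set of
standard elements has a common bound in `*Y`. -/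
def Concurrent {X Y : Type u} (r : Star 𝒰 (Set (X × Y))) : Prop :=
  ∀ C : Finset X, ∃ b : Star 𝒰 Y, ∀ x ∈ C, Germ.map₂ Prod.mk (x : Star 𝒰 X) b ∈ internalSet r

variable (𝒰)

/-- The ultrapower with respect to `𝒰` is a (saturated) enlargement of `V(U)`: it satisfies the
concurrency principle, i.e. for all sets `X, Y` belonging to `V(U)` and every internal relation
`r ⊆ *X × *Y` that is concurrent on `X` there is one element `b ∈ *Y` with `*x r b` for all
`x ∈ X`. -/
def IsEnlargement (U : Type u) : Prop :=
  ∀ (m n : ℕ) (X : Set (Level U m)) (Y : Set (Level U n)) (r : Star 𝒰 (Set (X × Y))),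
    Concurrent r → ∃ b : Star 𝒰 Y, ∀ x : X, Germ.map₂ Prod.mk (x : Star 𝒰 X) b ∈ internalSet r

end

/-! ### The `*`-transform of an algebra and its subalgebras -/

section

variable (L : FirstOrder.Language.{w, w'}) {I : Type v} (𝒰 : Ultrafilter I) (A : Type u) [L.Structure A]

/-- An operation symbol together with a tuple of arguments of the right length. -/
abbrev Application := Σ n : ℕ, L.Functions n × (Fin n → A)

variable {A}

/-- The result of applying an operation of the algebra `A` to a tuple of arguments. -/
def Application.value (p : Application L A) : A := FirstOrder.Language.Structure.funMap p.2.1 p.2.2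

/-- `a` is one of the arguments in `p`. -/
def Application.IsArg (p : Application L A) (a : A) : Prop := a ∈ Set.range p.2.2

variable {L 𝒰}

/-- An element `p` of `*Application` is an internal operation `o ∈ *𝒪`, of some arity `η ∈ *ℕ`,
together with an internal tuple `(x₁, …, x_η)` in `*A`; this is the value `o(x₁, …, x_η) ∈ *A`. -/
def starValue (p : Star 𝒰 (Application L A)) : Star 𝒰 A := p.map (Application.value L)

/-- `a` is one of the entries of the internal tuple of arguments in `p`. -/
def IsStarArg (p : Star 𝒰 (Application L A)) (a : Star 𝒰 A) : Prop :=
  Germ.LiftRel (Application.IsArg L) p a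

/-- On the copy of `A` in `*A`, the standard operations extend those of `A`. -/
theorem starValue_coe (n : ℕ) (f : L.Functions n) (x : Fin n → A) :
    starValue ((⟨n, f, x⟩ : Application L A) : Star 𝒰 (Application L A)) =
      ((FirstOrder.Language.Structure.funMap f x : A) : Star 𝒰 A) :=
  rfl

variable (L 𝒰 A)

/-- A (possibly external) subalgebra of `*A`: a subset of `*A` that is closed under all internal
operations, including those of hyperfinite arity. -/
@[ext]
structure StarSubalgebra where
  /-- The underlying set. -/
  carrier : Set (Star 𝒰 A)
  /-- Closure under the internal operations. -/
  closed : ∀ p : Star 𝒰 (Application L A), (∀ a, IsStarArg p a → a ∈ carrier) →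
    starValue p ∈ carrier

/-- The extension monad of `A`: the intersection of all internal subalgebras of `*A` that
contain (the canonical copy of) `A`. -/
def extensionMonad : StarSubalgebra L 𝒰 A where
  carrier := {x | ∀ B : StarSubalgebra L 𝒰 A, IsInternal B.carrier →
    (∀ a : A, (a : Star 𝒰 A) ∈ B.carrier) → x ∈ B.carrier}
  closed p hp B hB hA := B.closed p fun a ha => hp a ha B hB hA

/-! ### Internal iteration of the operations -/

variable {A}

/-- The sets obtained from `F ⊆ A` by iterating the operations: `A₀ = F`, and `Aₙ₊₁` consists of
the elements of `Aₙ` and the values of the operations on tuples from `Aₙ`. -/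
def stage : ℕ → Set A → Set A
  | 0, F => F
  | n + 1, F => stage n F ∪
      {a | ∃ p : Application L A, (∀ b, Application.IsArg L p b → b ∈ stage n F) ∧ Application.value L p = a}

/-- The internal iteration `(A_ν)`, `ν ∈ *ℕ`, with internal starting set `A₀ = F ∈ *𝒫(A)`:
the `*`-transform of `stage`. -/
def starStage (ν : Star 𝒰 ℕ) (F : Star 𝒰 (Set A)) : Set (Star 𝒰 A) :=
  internalSet (Germ.map₂ (stage L) ν F)

/-- The closure of a subset `G` of `*A` under hyperfinite internal iteration of the operations:
the union of all stages `A_ν`, `ν ∈ *ℕ`, of the internal iterations starting with an internal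
subset of `G`. (If `G` itself is internal, it is enough to start with `G`; if `G` is external,
there is no internal iteration starting with the whole of `G`.) -/
def check (G : Set (Star 𝒰 A)) : Set (Star 𝒰 A) :=
  {x | ∃ F : Star 𝒰 (Set A), internalSet F ⊆ G ∧ ∃ ν : Star 𝒰 ℕ, x ∈ starStage L 𝒰 ν F}

end

end ExtMonad

/-!
The inclusion of `check G` in the extension monad is transfer: an internal subalgebra `*S` is
closed under the operations in `𝒰`-almost every coordinate (`eventually_isClosedSet`), so if it
contains an internal set `F`, it contains all stages `A_ν(F)` (`starStage_subset`).

Conversely, let `x ∈ *A` be outside `check G`. A finite `F ⊆ G` is its own `*`-transform, and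
`⋃ ν, A_ν(F)` is the `*`-transform of the ordinary subalgebra `⟨F⟩` generated by `F`
(`iUnion_stage`); hence `x ∉ *⟨F⟩` for every finite `F ⊆ G`. As operations are finitary and `G`
generates, every finite set of elements of `A` lies in some `⟨F⟩` with `F ⊆ G` finite
(`exists_finite_subset_closure`). So the internal relation "`S` is a subalgebra, `a ∈ S` and
`x ∉ S`" between `a ∈ *A` and `S ∈ *𝒫(A)` is concurrent on `A`, and the concurrency principle
gives an internal subalgebra that contains `A` but not `x`
(`exists_internal_starSubalgebra_notMem`). Thus `x` is not in the extension monad.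
-/

namespace ExtMonad

open FirstOrder.Language

section

variable (L : FirstOrder.Language.{w, w'}) {A : Type u} [L.Structure A]

/-- A subset of an algebra is closed if it contains the value of every operation on arguments
taken from it. -/
def IsClosedSet (S : Set A) : Prop :=
  ∀ p : Application L A, (∀ a, Application.IsArg L p a → a ∈ S) → Application.value L p ∈ S

variable {L}

theorem isClosedSet_coe (S : L.Substructure A) : IsClosedSet L (S : Set A) := by
  rintro ⟨n, f, x⟩ h
  exact S.fun_mem f x fun k => h _ ⟨k, rfl⟩

theorem IsClosedSet.stage_subset {S F : Set A} (hS : IsClosedSet L S) (hF : F ⊆ S) (n : ℕ) :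
    stage L n F ⊆ S := by
  induction n with
  | zero => exact hF
  | succ n ih =>
    rintro a (ha | ⟨p, hp, rfl⟩)
    · exact ih ha
    · exact hS p fun b hb => ih (hp b hb)

theorem monotone_stage (F : Set A) : Monotone fun n => stage L n F :=
  monotone_nat_of_le_succ fun _ _ ha => Or.inl ha

/-- The standard iteration exhausts the generated subalgebra, because the arguments of an operation,
being finite in number, lie in a common stage. -/
theorem iUnion_stage (F : Set A) :
    ⋃ n, stage L n F = (Substructure.closure L F : Set A) := by
  apply Set.Subset.antisymm
  · exact Set.iUnion_subset
      ((isClosedSet_coe _).stage_subset Substructure.subset_closure)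
  · let S : L.Substructure A :=
      { carrier := ⋃ n, stage L n F
        fun_mem := by
          intro n f x hx
          choose m hm using fun k => Set.mem_iUnion.1 (hx k)
          refine Set.mem_iUnion.2 ⟨Finset.univ.sup m + 1, Or.inr ⟨⟨n, f, x⟩, ?_, rfl⟩⟩
          rintro _ ⟨k, rfl⟩
          exact monotone_stage F (Finset.le_sup (Finset.mem_univ k)) (hm k) }
    have hFS : F ⊆ S := fun a ha => Set.mem_iUnion.2 ⟨0, ha⟩
    exact Substructure.closure_le.2 hFS

/-- Finitary operations generate an algebraic closure operator: finitely many elements of a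
generated subalgebra are generated by finitely many of the generators. -/
theorem exists_finite_subset_closure (G : Set A) (C : Finset A)
    (hC : ∀ a ∈ C, a ∈ Substructure.closure L G) :
    ∃ F ⊆ G, F.Finite ∧ ∀ a ∈ C, a ∈ Substructure.closure L F := by
  let S : L.Substructure A :=
    { carrier := {a | ∃ F ⊆ G, F.Finite ∧ a ∈ Substructure.closure L F}
      fun_mem := by
        intro n f x hx
        choose F hFG hF hxF using hx
        refine ⟨⋃ k, F k, Set.iUnion_subset hFG, Set.finite_iUnion hF, ?_⟩
        exact Substructure.fun_mem _ f x fun k =>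
          Substructure.closure_mono (Set.subset_iUnion F k) (hxF k) }
  have hS : Substructure.closure L G ≤ S := Substructure.closure_le.2
    fun a ha => ⟨{a}, Set.singleton_subset_iff.2 ha, Set.finite_singleton a,
      Substructure.subset_closure rfl⟩
  choose F hFG hF hCF using fun a : C => hS (hC a a.2)
  refine ⟨⋃ a, F a, Set.iUnion_subset hFG, Set.finite_iUnion hF, fun a ha => ?_⟩
  exact Substructure.closure_mono (Set.subset_iUnion F ⟨a, ha⟩) (hCF ⟨a, ha⟩)

end

section

variable {I : Type v} {𝒰 : Ultrafilter I}

theorem coe_mem_internalSet_coe {X : Type*} {x : I → X} {s : I → Set X} :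
    (x : Star 𝒰 X) ∈ internalSet (s : Star 𝒰 (Set X)) ↔ ∀ᶠ i in 𝒰, x i ∈ s i :=
  Iff.rfl

theorem eventually_subset_of_internalSet_subset {X : Type*} {s t : I → Set X}
    (h : internalSet (s : Star 𝒰 (Set X)) ⊆ internalSet (t : Star 𝒰 (Set X))) :
    ∀ᶠ i in 𝒰, s i ⊆ t i := by
  by_contra hn
  have hn' : ∀ᶠ i in 𝒰, ∃ a, a ∈ s i ∧ a ∉ t i := by
    simpa only [Set.not_subset] using Ultrafilter.eventually_not.2 hn
  obtain ⟨i₀, a₀, -⟩ := hn'.exists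
  have : Nonempty X := ⟨a₀⟩
  obtain ⟨x, hx⟩ := hn'.choice
  obtain ⟨i, hi, hi'⟩ :=
    ((coe_mem_internalSet_coe.1 (h (coe_mem_internalSet_coe.2 (hx.mono fun _ hi => hi.1)))).and
      hx).exists
  exact hi'.2 hi

/-- A finite set has no nonstandard elements. -/
theorem internalSet_coe_finite {X : Type*} {F : Set X} (hF : F.Finite) :
    internalSet ((fun _ => F : I → Set X) : Star 𝒰 (Set X)) ⊆
      (fun a : X => (a : Star 𝒰 X)) '' F := by
  intro x
  induction x using Germ.inductionOn with
  | _ x =>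
    intro hx
    have hx' : ∀ᶠ i in 𝒰, ∃ a ∈ F, x i = a :=
      (coe_mem_internalSet_coe.1 hx).mono fun i hi => ⟨x i, hi, rfl⟩
    obtain ⟨a, ha, hxa⟩ := (Ultrafilter.eventually_exists_mem_iff hF).1 hx'
    exact ⟨a, ha, (Germ.coe_eq.2 hxa).symm⟩

variable {L : FirstOrder.Language.{w, w'}} {A : Type u} [L.Structure A]

/-- Counterexamples to closure in almost all coordinates would assemble into an internal operation
with internal arguments, possibly of hyperfinite arity, that leads out of the internal set. -/
theorem eventually_isClosedSet {S : I → Set A}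
    (h : ∀ p : Star 𝒰 (Application L A),
      (∀ a, IsStarArg p a → a ∈ internalSet (S : Star 𝒰 (Set A))) →
        starValue p ∈ internalSet (S : Star 𝒰 (Set A))) :
    ∀ᶠ i in 𝒰, IsClosedSet L (S i) := by
  by_contra hn
  have hn' : ∀ᶠ i in 𝒰, ∃ p : Application L A,
      (∀ a, Application.IsArg L p a → a ∈ S i) ∧ Application.value L p ∉ S i := by
    simpa only [IsClosedSet, not_forall, exists_prop] using Ultrafilter.eventually_not.2 hn
  obtain ⟨i₀, p₀, -⟩ := hn'.exists
  have : Nonempty (Application L A) := ⟨p₀⟩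
  obtain ⟨p, hp⟩ := hn'.choice
  have hv : ∀ᶠ i in 𝒰, Application.value L (p i) ∈ S i := by
    refine h (p : Star 𝒰 (Application L A)) fun a => ?_
    induction a using Germ.inductionOn with
    | _ a =>
      intro ha
      have ha' : ∀ᶠ i in 𝒰, Application.IsArg L (p i) (a i) := ha
      exact (hp.and ha').mono fun i hi => hi.1.1 _ hi.2
  obtain ⟨i, hi, hi'⟩ := (hv.and hp).exists
  exact hi'.2 hi

/-- The internal subalgebra of `*A` given by a family of subsets of `A` almost all of which are
closed. -/
def StarSubalgebra.ofEventually (S : I → Set A) (hS : ∀ᶠ i in 𝒰, IsClosedSet L (S i)) :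
    StarSubalgebra L 𝒰 A where
  carrier := internalSet (S : Star 𝒰 (Set A))
  closed p := by
    induction p using Germ.inductionOn with
    | _ p =>
      intro hp
      have hargs : ∀ᶠ i in 𝒰, {a | Application.IsArg L (p i) a} ⊆ S i := by
        apply eventually_subset_of_internalSet_subset
        intro a
        induction a using Germ.inductionOn with
        | _ a => exact fun ha => hp _ ha
      exact (hS.and hargs).mono fun i hi => hi.1 (p i) hi.2

theorem starStage_subset (B : StarSubalgebra L 𝒰 A) (hB : IsInternal B.carrier)
    (F : Star 𝒰 (Set A)) (hF : internalSet F ⊆ B.carrier) (ν : Star 𝒰 ℕ) :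
    starStage L 𝒰 ν F ⊆ B.carrier := by
  obtain ⟨S, hS⟩ := hB
  induction S using Germ.inductionOn with | _ S
  induction F using Germ.inductionOn with | _ F
  induction ν using Germ.inductionOn with | _ ν
  have hcl : ∀ᶠ i in 𝒰, IsClosedSet L (S i) :=
    eventually_isClosedSet fun p hp => hS ▸ B.closed p fun a ha => hS ▸ hp a ha
  rw [hS] at hF ⊢
  have hFS := eventually_subset_of_internalSet_subset hF
  intro x
  induction x using Germ.inductionOn with
  | _ x =>
    intro hx
    have hx' : ∀ᶠ i in 𝒰, x i ∈ stage L (ν i) (F i) := hx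
    exact (hcl.and (hFS.and hx')).mono fun i hi => hi.1.stage_subset hi.2.1 _ hi.2.2

/-- For finite `F ⊆ G`, the `*`-transform of the subalgebra generated by `F` is part of
`check G`. -/
theorem coe_mem_check_of_eventually_mem_closure {G F : Set A} (hFG : F ⊆ G) (hF : F.Finite)
    {x : I → A} (hx : ∀ᶠ i in 𝒰, x i ∈ Substructure.closure L F) :
    (x : Star 𝒰 A) ∈ check L 𝒰 ((fun a : A => (a : Star 𝒰 A)) '' G) := by
  have hx' : ∀ᶠ i in 𝒰, ∃ n, x i ∈ stage L n F := hx.mono fun i hi => by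
    rwa [← SetLike.mem_coe, ← iUnion_stage, Set.mem_iUnion] at hi
  obtain ⟨ν, hν⟩ := hx'.choice
  exact ⟨((fun _ => F : I → Set A) : Star 𝒰 (Set A)),
    (internalSet_coe_finite hF).trans (Set.image_mono hFG), (ν : Star 𝒰 ℕ), hν⟩

end

/-- The subset of `A ⊆ U` cut out by an element of `V₁(U) = U ∪ 𝒫(U)`; urelements have no
elements. -/
def levelOneTrace {U : Type u} (A : Set U) : Level U 1 → Set A :=
  Sum.elim (fun _ => ∅) fun S => {a | (a : U) ∈ S}

theorem levelOneTrace_surjective {U : Type u} (A : Set U) :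
    Function.Surjective (levelOneTrace A) := fun S =>
  ⟨Sum.inr (Subtype.val '' S), Set.preimage_image_eq S Subtype.val_injective⟩

/-- Concurrency separates a point of `*A` from `A` by an internal subalgebra as soon as it lies in
no `*⟨F⟩`, for `F` a finite set of generators. -/
theorem exists_internal_starSubalgebra_notMem {U : Type u} {I : Type v} {𝒰 : Ultrafilter I}
    (h𝒰 : IsEnlargement 𝒰 U) {L : FirstOrder.Language.{w, w'}} {A : Set U} [L.Structure A]
    {G : Set A} (hG : Substructure.closure L G = ⊤) {x : I → A}
    (hx : ∀ F ⊆ G, F.Finite → ∀ᶠ i in 𝒰, x i ∉ Substructure.closure L F) :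
    ∃ B : StarSubalgebra L 𝒰 A, IsInternal B.carrier ∧ (∀ a : A, (a : Star 𝒰 A) ∈ B.carrier) ∧
      (x : Star 𝒰 A) ∉ B.carrier := by
  let r : I → Set (A × (Set.univ : Set (Level U 1))) := fun i =>
    {q | q.1 ∈ levelOneTrace A q.2.1 ∧ IsClosedSet L (levelOneTrace A q.2.1) ∧
      x i ∉ levelOneTrace A q.2.1}
  have hr : Concurrent (r : Star 𝒰 (Set (A × (Set.univ : Set (Level U 1))))) := by
    intro C
    obtain ⟨F, hFG, hF, hC⟩ := exists_finite_subset_closure (L := L) G C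
      fun a _ => hG ▸ Substructure.mem_top a
    obtain ⟨y, hy⟩ := levelOneTrace_surjective A (Substructure.closure L F : Set A)
    refine ⟨((fun _ => ⟨y, trivial⟩ : I → (Set.univ : Set (Level U 1))) : Germ _ _),
      fun a ha => ?_⟩
    refine (hx F hFG hF).mono fun i hi => ?_
    change a ∈ levelOneTrace A y ∧ IsClosedSet L (levelOneTrace A y) ∧ x i ∉ levelOneTrace A y
    rw [hy]
    exact ⟨hC a ha, isClosedSet_coe _, hi⟩
  -- `A` is a set in `V(U)` because `Level U 0` is `U` by definition.
  obtain ⟨b, hb⟩ := h𝒰 0 1 A Set.univ _ hr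
  induction b using Germ.inductionOn with | _ b
  have hb' : ∀ a : A, ∀ᶠ i in 𝒰, a ∈ levelOneTrace A (b i).1 ∧
      IsClosedSet L (levelOneTrace A (b i).1) ∧ x i ∉ levelOneTrace A (b i).1 := hb
  -- Some element of `A` is needed to read off from `hb'` the conditions not involving it.
  obtain ⟨i₀⟩ := (𝒰 : Filter I).nonempty_of_neBot
  have h₀ := hb' (x i₀)
  refine ⟨.ofEventually (fun i => levelOneTrace A (b i).1) (h₀.mono fun i hi => hi.2.1),
    ⟨_, rfl⟩, fun a => (hb' a).mono fun i hi => hi.1, fun hmem => ?_⟩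
  obtain ⟨i, hi, hi'⟩ := (h₀.and (coe_mem_internalSet_coe.1 hmem)).exists
  exact hi.2.2 hi'

end ExtMonad

theorem mainTheorem10 {U : Type u} {I : Type v} (𝒰 : Ultrafilter I)
    (h𝒰 : ExtMonad.IsEnlargement 𝒰 U)
    (L : FirstOrder.Language.{w, w'}) [L.IsAlgebraic] (A : Set U) [L.Structure A]
    (G : Set A) (hG : FirstOrder.Language.Substructure.closure L G = ⊤) :
    (ExtMonad.extensionMonad L 𝒰 A).carrier =
      ExtMonad.check L 𝒰 ((fun a : A => (a : ExtMonad.Star 𝒰 A)) '' G) := by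
  apply Set.Subset.antisymm
  · intro x
    induction x using Germ.inductionOn with
    | _ x =>
      intro hx
      by_contra hxG
      obtain ⟨B, hB, hAB, hxB⟩ := ExtMonad.exists_internal_starSubalgebra_notMem h𝒰 hG (x := x)
        fun F hFG hF => Ultrafilter.eventually_not.2 fun h =>
          hxG (ExtMonad.coe_mem_check_of_eventually_mem_closure hFG hF h)
      exact hxB (hx B hB hAB)
  · rintro x ⟨F, hFG, ν, hx⟩ B hB hAB
    refine ExtMonad.starStage_subset B hB F (hFG.trans ?_) ν hx
    rintro _ ⟨a, -, rfl⟩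
    exact hAB a
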